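/- **Setting.** Let $\Omega\subset\mathbb R^d$ be compact with Lebesgue measure $\nu(\Omega)=1$, let $S\subset\mathbb R$ be a bounded Borel set and $m$ a Borel measure on $\mathbb R$ with $m(S)=1$. Let $\mathcal X$ (contexts) and $\mathcal A$ (actions) be sets, and for $x\in\mathcal X$, $a\in\mathcal A$, $w\in\Omega$ let $s\mapsto\phi(x,a,w,s)$ be the cumulative distribution function of an $S$-valued random variable, measurable in $w$. For $M\in\mathbb R$ put $\mathcal C=\{\theta\in L^2(\Omega,\nu):\theta\ge 0,\ \int_\Omega\theta\,d\nu=1,\ \|\theta\|_{L^2(\Omega,\nu)}\le M\}$, and let $\theta^*\in\mathcal C$ be an unknown coefficient function. Let $0<\gamma\le 1$. **Data.** Let $n\ge 1$, let $(x_j,a_j)\in\mathcal X\times\mathcal A$, $1\le j\le n$, be an arbitrary fixed design, and let $y_1,\dots,y_n$ be independent $S$-valued random variables such that $y_j$ has distribution function $F^*(x_j,a_j,s)=\int_\Omega\theta^*(w)\phi(x_j,a_j,w,s)\,d\nu(w)$, $s\in S$. Put $\mathcal D=\{(x_j,a_j,y_j)\}_{j=1}^n$. **Design operator.** On $L^2(\Omega,\nu)$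 let $$\mathcal U_{\mathcal D}(\theta)(w)=\sum_{j=1}^n\int_\Omega\theta(r)\Big(\int_S\phi(x_j,a_j,w,s)\phi(x_j,a_j,r,s)\,dm(s)\Big)d\nu(r),\qquad \|\theta\|_{\mathcal U_{\mathcal D}}=\sqrt{\langle\theta,\mathcal U_{\mathcal D}\theta\rangle},$$ and let $\mathcal U_{\mathcal D}=\sum_{i\ge1}\lambda_i\langle\cdot,e_i\rangle e_i$ be a spectral decomposition, where $\lambda_1\ge\lambda_2\ge\cdots\ge 0$, $\lambda_i=\lambda_i(\mathcal U_{\mathcal D})\to0$, are the eigenvalues with multiplicity (padded by zeros if only finitely many are positive) and the $e_i$ with $\lambda_i\ne0$ are orthonormal. **Oracle.** Let $\varepsilon^*=n^{-2/(\gamma+2)}$ and let $N_{\varepsilon^*}$ be the smallest $N\ge 0$ such that $\lambda_i<n\varepsilon^*$ for all $i\ge N+1$. With $$g=\int_S\sum_{j=1}^n\mathbf 1\{y_j\le s\}\,\phi(x_j,a_j,\cdot,s)\,dm(s),\qquad \theta_{\mathcal D}=\sum_{i=1}^{N_{\varepsilon^*}}\frac1{\lambda_i}\langle g,e_i\rangle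 e_i,$$ the oracle's output $\hat\theta_{\mathcal D}$ is a projection of $\theta_{\mathcal D}$ onto $\mathcal C$ in $\|\cdot\|_{\mathcal U_{\mathcal D}}$, i.e. $\hat\theta_{\mathcal D}\in\mathcal C$ is any minimizer of $z\mapsto\|z-\theta_{\mathcal D}\|_{\mathcal U_{\mathcal D}}^2$ over $z\in\mathcal C$. **Theorem.** For every $\delta\in(0,1)$, with probability at least $1-\delta$, $$\|\hat\theta_{\mathcal D}-\theta^*\|_{\mathcal U_{\mathcal D}}\le\sqrt{2\Big(2\log\frac1\delta+\sum_{i=1}^{N_{\varepsilon^*}}\log\big(1+\lambda_i(\mathcal U_{\mathcal D})\big)\Big)}+n^{\frac{\gamma}{\gamma+2}}M .$$ -/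

import Mathlib

open MeasureTheory ProbabilityTheory Filter Topology
open scoped InnerProductSpace

noncomputable section

namespace FunctionalRegression

/-- The ambient data of the functional regression model: a compact index set `Ω ⊆ ℝᵈ` of Lebesgue
measure one, a bounded Borel set `S ⊆ ℝ` with `m S = 1` in which the responses live, and a family
`φ x a w` (`w ∈ Ω`) of cumulative distribution functions of `S`-valued random variables,
measurable in `w`. -/
structure Model (𝒳 𝒜 : Type*) (d : ℕ) where
  Ω : Set (EuclideanSpace ℝ (Fin d))
  isCompact_Ω : IsCompact Ω
  volume_Ω : volume Ω = 1
  S : Set ℝ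
  isBounded_S : Bornology.IsBounded S
  measurableSet_S : MeasurableSet S
  m : Measure ℝ
  m_S : m S = 1
  φ : 𝒳 → 𝒜 → EuclideanSpace ℝ (Fin d) → ℝ → ℝ
  φ_cdf : ∀ x a, ∀ w ∈ Ω, ∃ P : Measure ℝ, IsProbabilityMeasure P ∧ P Sᶜ = 0 ∧
    ∀ s, φ x a w s = P.real (Set.Iic s)
  φ_measurable : ∀ x a s, Measurable fun w : Ω => φ x a w s

variable {𝒳 𝒜 : Type*} {d : ℕ}

namespace Model

variable (Q : Model 𝒳 𝒜 d)

/-- Lebesgue measure `ν` on `Ω`. -/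
def ν : Measure (EuclideanSpace ℝ (Fin d)) := volume.restrict Q.Ω

/-- The measure `m` on `S`. -/
def mS : Measure ℝ := Q.m.restrict Q.S

/-- The real Hilbert space `L²(Ω, ν)`. -/
abbrev H : Type := Lp ℝ 2 Q.ν

instance : IsProbabilityMeasure Q.ν := ⟨by simp [ν, Q.volume_Ω]⟩

instance : IsProbabilityMeasure Q.mS := ⟨by simp [mS, Q.m_S]⟩

theorem measurableSet_Ω : MeasurableSet Q.Ω := Q.isCompact_Ω.isClosed.measurableSet

theorem ae_mem_Ω : ∀ᵐ w ∂Q.ν, w ∈ Q.Ω := ae_restrict_mem Q.measurableSet_Ω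

theorem φ_nonneg (x : 𝒳) (a : 𝒜) {w : EuclideanSpace ℝ (Fin d)} (hw : w ∈ Q.Ω) (s : ℝ) :
    0 ≤ Q.φ x a w s := by
  obtain ⟨P, hP, -, h⟩ := Q.φ_cdf x a w hw
  rw [h s]; exact measureReal_nonneg

theorem φ_le_one (x : 𝒳) (a : 𝒜) {w : EuclideanSpace ℝ (Fin d)} (hw : w ∈ Q.Ω) (s : ℝ) :
    Q.φ x a w s ≤ 1 := by
  obtain ⟨P, hP, -, h⟩ := Q.φ_cdf x a w hw
  rw [h s]; exact measureReal_le_one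

/-- `φ` extended by zero outside `Ω`; a technical device for measurability proofs. -/
def φ₀ (x : 𝒳) (a : 𝒜) (p : EuclideanSpace ℝ (Fin d) × ℝ) : ℝ :=
  Q.Ω.indicator (fun w => Q.φ x a w p.2) p.1

theorem φ₀_eq (x : 𝒳) (a : 𝒜) {w : EuclideanSpace ℝ (Fin d)} (hw : w ∈ Q.Ω) (s : ℝ) :
    Q.φ₀ x a (w, s) = Q.φ x a w s := by simp [φ₀, hw]

theorem norm_φ₀_le (x : 𝒳) (a : 𝒜) (p : EuclideanSpace ℝ (Fin d) × ℝ) : ‖Q.φ₀ x a p‖ ≤ 1 := by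
  by_cases hw : p.1 ∈ Q.Ω
  · have : Q.φ₀ x a p = Q.φ x a p.1 p.2 := by simp [φ₀, hw]
    rw [this, Real.norm_of_nonneg (Q.φ_nonneg x a hw _)]
    exact Q.φ_le_one x a hw _
  · simp [φ₀, hw]

theorem measurable_φ₀ (x : 𝒳) (a : 𝒜) : Measurable (Q.φ₀ x a) := by
  have hsec : ∀ s, Measurable fun w => Q.φ₀ x a (w, s) := by
    intro s
    refine measurable_of_restrict_of_restrict_compl Q.measurableSet_Ω ?_ ?_
    · convert Q.φ_measurable x a s using 1
      ext w; simp [φ₀]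
    · convert (measurable_const : Measurable fun _ : (Q.Ωᶜ : Set _) => (0 : ℝ)) using 1
      ext w
      have := w.2
      simp only [Set.mem_compl_iff] at this
      simp [φ₀, this]
  have happ : ∀ k : ℕ, Measurable fun p : EuclideanSpace ℝ (Fin d) × ℝ =>
      Q.φ₀ x a (p.1, ((⌊(k + 1 : ℝ) * p.2⌋ : ℝ) + 1) / (k + 1)) := by
    intro k
    have h1 : Measurable fun q : EuclideanSpace ℝ (Fin d) × ℤ =>
        Q.φ₀ x a (q.1, ((q.2 : ℝ) + 1) / (k + 1)) :=
      measurable_from_prod_countable_left (fun z => hsec (((z : ℝ) + 1) / (k + 1)))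
    have h2 : Measurable fun p : EuclideanSpace ℝ (Fin d) × ℝ =>
        (p.1, ⌊(k + 1 : ℝ) * p.2⌋) := by fun_prop
    exact h1.comp h2
  refine measurable_of_tendsto_metrizable happ ?_
  rw [tendsto_pi_nhds]
  rintro ⟨w, s⟩
  by_cases hw : w ∈ Q.Ω
  · simp only [Q.φ₀_eq x a hw]
    obtain ⟨P, hP, -, h⟩ := Q.φ_cdf x a w hw
    have hc : ∀ t, Q.φ x a w t = cdf P t := fun t => by rw [h, cdf_eq_real]
    simp only [hc]
    have hr : ContinuousWithinAt (cdf P) (Set.Ioi s) s :=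
      ((cdf P).right_continuous s).mono Set.Ioi_subset_Ici_self
    refine hr.tendsto.comp (tendsto_nhdsWithin_iff.2 ⟨?_, Eventually.of_forall fun k => ?_⟩)
    · refine tendsto_of_tendsto_of_tendsto_of_le_of_le (g := fun _ => s)
        (h := fun k : ℕ => s + 1 / ((k : ℝ) + 1)) tendsto_const_nhds ?_ ?_ ?_
      · simpa using (tendsto_const_nhds (x := s)).add (tendsto_one_div_add_atTop_nhds_zero_nat (𝕜 := ℝ))
      · intro k
        have hk : (0 : ℝ) < k + 1 := by positivity
        have := Int.lt_floor_add_one ((k + 1 : ℝ) * s)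
        simp only [le_div_iff₀ hk]; linarith
      · intro k
        have hk : (0 : ℝ) < k + 1 := by positivity
        have := Int.floor_le ((k + 1 : ℝ) * s)
        simp only [div_le_iff₀ hk]
        field_simp
        linarith
    · have hk : (0 : ℝ) < k + 1 := by positivity
      have := Int.lt_floor_add_one ((k + 1 : ℝ) * s)
      simp only [Set.mem_Ioi, lt_div_iff₀ hk]; linarith
  · simp [φ₀, hw]

/-- The integral kernel `K^{x,a}(w, r) = ∫_S φ(x,a,w,s) φ(x,a,r,s) dm(s)`. -/
def kernel (x : 𝒳) (a : 𝒜) (w r : EuclideanSpace ℝ (Fin d)) : ℝ :=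
  ∫ s, Q.φ x a w s * Q.φ x a r s ∂Q.mS

theorem norm_kernel_le (x : 𝒳) (a : 𝒜) {w r : EuclideanSpace ℝ (Fin d)} (hw : w ∈ Q.Ω)
    (hr : r ∈ Q.Ω) : ‖Q.kernel x a w r‖ ≤ 1 := by
  have := norm_integral_le_of_norm_le_const (μ := Q.mS)
    (f := fun s => Q.φ x a w s * Q.φ x a r s) (C := 1) (ae_of_all _ fun s => by
      rw [norm_mul, Real.norm_of_nonneg (Q.φ_nonneg x a hw s),
        Real.norm_of_nonneg (Q.φ_nonneg x a hr s)]
      exact mul_le_one₀ (Q.φ_le_one x a hw s) (Q.φ_nonneg x a hr s) (Q.φ_le_one x a hr s))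
  simpa [kernel] using this

theorem stronglyMeasurable_kernel₀ (x : 𝒳) (a : 𝒜) :
    StronglyMeasurable fun p : EuclideanSpace ℝ (Fin d) × EuclideanSpace ℝ (Fin d) =>
      ∫ s, Q.φ₀ x a (p.1, s) * Q.φ₀ x a (p.2, s) ∂Q.mS := by
  have hm := Q.measurable_φ₀ x a
  refine StronglyMeasurable.integral_prod_right
    (f := fun (p : EuclideanSpace ℝ (Fin d) × EuclideanSpace ℝ (Fin d)) (s : ℝ) =>
      Q.φ₀ x a (p.1, s) * Q.φ₀ x a (p.2, s)) (Measurable.stronglyMeasurable ?_)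
  exact (hm.comp (by fun_prop : Measurable fun q : (EuclideanSpace ℝ (Fin d) ×
      EuclideanSpace ℝ (Fin d)) × ℝ => (q.1.1, q.2))).mul
    (hm.comp (by fun_prop : Measurable fun q : (EuclideanSpace ℝ (Fin d) ×
      EuclideanSpace ℝ (Fin d)) × ℝ => (q.1.2, q.2)))

theorem kernel₀_eq (x : 𝒳) (a : 𝒜) {w r : EuclideanSpace ℝ (Fin d)} (hw : w ∈ Q.Ω)
    (hr : r ∈ Q.Ω) :
    ∫ s, Q.φ₀ x a (w, s) * Q.φ₀ x a (r, s) ∂Q.mS = Q.kernel x a w r := by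
  simp [kernel, Q.φ₀_eq x a hw, Q.φ₀_eq x a hr]

theorem aestronglyMeasurable_kernel (x : 𝒳) (a : 𝒜) {w : EuclideanSpace ℝ (Fin d)}
    (hw : w ∈ Q.Ω) : AEStronglyMeasurable (Q.kernel x a w) Q.ν := by
  refine ⟨_, (Q.stronglyMeasurable_kernel₀ x a).comp_measurable
    (measurable_prodMk_left (x := w)), ?_⟩
  filter_upwards [Q.ae_mem_Ω] with r hr
  exact (Q.kernel₀_eq x a hw hr).symm

theorem integrable_H (θ : Q.H) : Integrable θ Q.ν :=
  memLp_one_iff_integrable.1 ((Lp.memLp θ).mono_exponent (by norm_num))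

theorem integrable_mul_kernel (x : 𝒳) (a : 𝒜) (θ : Q.H) {w : EuclideanSpace ℝ (Fin d)}
    (hw : w ∈ Q.Ω) : Integrable (fun r => θ r * Q.kernel x a w r) Q.ν := by
  refine (Q.integrable_H θ).mul_bdd (c := 1) (Q.aestronglyMeasurable_kernel x a hw) ?_
  filter_upwards [Q.ae_mem_Ω] with r hr using Q.norm_kernel_le x a hw hr

/-- `L^{x,a}(θ)(w) = ∫_Ω θ(r) K^{x,a}(w, r) dν(r)`, as a function on `Ω`. -/
def intOpFun (x : 𝒳) (a : 𝒜) (θ : Q.H) (w : EuclideanSpace ℝ (Fin d)) : ℝ :=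
  ∫ r, θ r * Q.kernel x a w r ∂Q.ν

theorem integral_norm_le (θ : Q.H) : ∫ r, ‖θ r‖ ∂Q.ν ≤ ‖θ‖ := by
  have h1 : eLpNorm θ 1 Q.ν ≤ eLpNorm θ 2 Q.ν :=
    eLpNorm_le_eLpNorm_of_exponent_le (by norm_num) (Lp.aestronglyMeasurable θ)
  rw [eLpNorm_one_eq_lintegral_enorm] at h1
  rw [integral_norm_eq_lintegral_enorm (Lp.aestronglyMeasurable θ), Lp.norm_def]
  exact ENNReal.toReal_mono (Lp.eLpNorm_ne_top θ) h1

theorem norm_intOpFun_le (x : 𝒳) (a : 𝒜) (θ : Q.H) {w : EuclideanSpace ℝ (Fin d)}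
    (hw : w ∈ Q.Ω) : ‖Q.intOpFun x a θ w‖ ≤ ‖θ‖ := by
  refine (norm_integral_le_integral_norm _).trans (le_trans ?_ (Q.integral_norm_le θ))
  refine integral_mono_ae (Q.integrable_mul_kernel x a θ hw).norm (Q.integrable_H θ).norm ?_
  filter_upwards [Q.ae_mem_Ω] with r hr
  simpa [norm_mul] using mul_le_of_le_one_right (abs_nonneg (θ r)) (Q.norm_kernel_le x a hw hr)

theorem aestronglyMeasurable_intOpFun (x : 𝒳) (a : 𝒜) (θ : Q.H) :
    AEStronglyMeasurable (Q.intOpFun x a θ) Q.ν := by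
  obtain ⟨g, hg, hgθ⟩ := Lp.aestronglyMeasurable θ
  refine ⟨fun w => ∫ r, g r * ∫ s, Q.φ₀ x a (w, s) * Q.φ₀ x a (r, s) ∂Q.mS ∂Q.ν, ?_, ?_⟩
  · exact StronglyMeasurable.integral_prod_right
      (f := fun w r => g r * ∫ s, Q.φ₀ x a (w, s) * Q.φ₀ x a (r, s) ∂Q.mS)
      ((hg.comp_measurable measurable_snd).mul (Q.stronglyMeasurable_kernel₀ x a))
  · filter_upwards [Q.ae_mem_Ω] with w hw
    refine integral_congr_ae ?_
    filter_upwards [Q.ae_mem_Ω, hgθ] with r hr hgr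
    rw [hgr, Q.kernel₀_eq x a hw hr]

theorem memLp_intOpFun (x : 𝒳) (a : 𝒜) (θ : Q.H) : MemLp (Q.intOpFun x a θ) 2 Q.ν :=
  MemLp.of_bound (Q.aestronglyMeasurable_intOpFun x a θ) ‖θ‖ (by
    filter_upwards [Q.ae_mem_Ω] with w hw using Q.norm_intOpFun_le x a θ hw)

/-- The integral operator `L^{x,a}` on `L²(Ω, ν)`. -/
def intOp (x : 𝒳) (a : 𝒜) : Q.H →L[ℝ] Q.H :=
  LinearMap.mkContinuous
    { toFun := fun θ => (Q.memLp_intOpFun x a θ).toLp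
      map_add' := fun θ η => by
        rw [← MemLp.toLp_add]
        refine MemLp.toLp_congr _ _ ?_
        filter_upwards [Q.ae_mem_Ω] with w hw
        rw [Pi.add_apply, intOpFun, intOpFun, intOpFun, ← integral_add
          (Q.integrable_mul_kernel x a θ hw) (Q.integrable_mul_kernel x a η hw)]
        refine integral_congr_ae ?_
        filter_upwards [Lp.coeFn_add θ η] with r hr
        rw [hr, Pi.add_apply, add_mul]
      map_smul' := fun c θ => by
        rw [RingHom.id_apply, ← MemLp.toLp_const_smul]
        refine MemLp.toLp_congr _ _ (ae_of_all _ fun w => ?_)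
        rw [Pi.smul_apply, intOpFun, intOpFun, smul_eq_mul, ← integral_const_mul]
        refine integral_congr_ae ?_
        filter_upwards [Lp.coeFn_smul c θ] with r hr
        rw [hr, Pi.smul_apply, smul_eq_mul, mul_assoc] }
    1 (fun θ => by
      have := Lp.norm_le_of_ae_bound (f := (Q.memLp_intOpFun x a θ).toLp) (norm_nonneg θ) (by
        filter_upwards [Q.ae_mem_Ω, (Q.memLp_intOpFun x a θ).coeFn_toLp] with w hw h
        rw [h]; exact Q.norm_intOpFun_le x a θ hw)
      simpa [measureUnivNNReal] using this)

theorem intOp_apply_ae (x : 𝒳) (a : 𝒜) (θ : Q.H) :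
    Q.intOp x a θ =ᵐ[Q.ν] Q.intOpFun x a θ := (Q.memLp_intOpFun x a θ).coeFn_toLp

/-- `F_θ(x, a, s) = ∫_Ω θ(w) φ(x,a,w,s) dν(w)`. -/
def mixture (θ : Q.H) (x : 𝒳) (a : 𝒜) (s : ℝ) : ℝ := ∫ w, θ w * Q.φ x a w s ∂Q.ν

/-- The set `C` of admissible coefficient functions: nonnegative, of integral one, of `L²` norm
at most `M`. -/
def coeffSet (M : ℝ) : Set Q.H := {θ | 0 ≤ᵐ[Q.ν] θ ∧ ∫ w, θ w ∂Q.ν = 1 ∧ ‖θ‖ ≤ M}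

section Design

variable {n : ℕ} (x : Fin n → 𝒳) (a : Fin n → 𝒜)

/-- The design integral operator `U_D = ∑ⱼ L^{xⱼ,aⱼ}`. -/
def designOp : Q.H →L[ℝ] Q.H := ∑ j, Q.intOp (x j) (a j)

/-- The function `w ↦ ∫_S ∑ⱼ 𝟙{yⱼ ≤ s} φ(xⱼ,aⱼ,w,s) dm(s)`. -/
def responseFun (y : Fin n → ℝ) (w : EuclideanSpace ℝ (Fin d)) : ℝ :=
  ∫ s, ∑ j, (Set.Ici (y j)).indicator (fun _ => (1 : ℝ)) s * Q.φ (x j) (a j) w s ∂Q.mS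

theorem memLp_responseFun (y : Fin n → ℝ) : MemLp (Q.responseFun x a y) 2 Q.ν := by
  refine MemLp.of_bound ⟨fun w => ∫ s, ∑ j, (Set.Ici (y j)).indicator (fun _ => (1 : ℝ)) s *
      Q.φ₀ (x j) (a j) (w, s) ∂Q.mS, ?_, ?_⟩ n ?_
  · refine StronglyMeasurable.integral_prod_right (f := fun (w : EuclideanSpace ℝ (Fin d)) s =>
      ∑ j, (Set.Ici (y j)).indicator (fun _ => (1 : ℝ)) s * Q.φ₀ (x j) (a j) (w, s))
      (Measurable.stronglyMeasurable ?_)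
    refine Finset.measurable_sum _ fun j _ => Measurable.mul ?_ (Q.measurable_φ₀ (x j) (a j))
    exact (measurable_const.indicator measurableSet_Ici).comp measurable_snd
  · filter_upwards [Q.ae_mem_Ω] with w hw
    simp [responseFun, Q.φ₀_eq _ _ hw]
  · filter_upwards [Q.ae_mem_Ω] with w hw
    have := norm_integral_le_of_norm_le_const (μ := Q.mS) (C := (n : ℝ)) (f := fun s =>
        ∑ j, (Set.Ici (y j)).indicator (fun _ => (1 : ℝ)) s * Q.φ (x j) (a j) w s)
      (ae_of_all _ fun s => by
        refine (norm_sum_le _ _).trans ?_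
        refine (Finset.sum_le_card_nsmul _ _ 1 fun j _ => ?_).trans (by simp)
        rw [norm_mul, Real.norm_of_nonneg (Q.φ_nonneg _ _ hw s)]
        refine mul_le_one₀ ?_ (Q.φ_nonneg _ _ hw s) (Q.φ_le_one _ _ hw s)
        by_cases h : s ∈ Set.Ici (y j) <;> simp [Set.indicator, h])
    simpa [responseFun] using this

/-- The element of `L²(Ω, ν)` given by `responseFun`. -/
def response (y : Fin n → ℝ) : Q.H := (Q.memLp_responseFun x a y).toLp

end Design

end Model

/-- `(lam, e)` is a spectral decomposition `U = ∑ᵢ lamᵢ ⟨·, eᵢ⟩ eᵢ` of a positive compact operator: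
`lam` is the decreasing null sequence of eigenvalues, repeated according to multiplicity (and padded
by zeros if there are only finitely many positive ones), and the `eᵢ` with `lamᵢ ≠ 0` are
orthonormal. Indices start at `0`. -/
structure IsSpectralDecomposition {H : Type*} [NormedAddCommGroup H] [InnerProductSpace ℝ H]
    (U : H →L[ℝ] H) (lam : ℕ → ℝ) (e : ℕ → H) : Prop where
  antitone : Antitone lam
  tendsto_zero : Tendsto lam atTop (𝓝 0)
  orthonormal : Orthonormal ℝ fun i : {i : ℕ // lam i ≠ 0} => e i
  hasSum : ∀ θ, HasSum (fun i => (lam i * ⟪θ, e i⟫_ℝ) • e i) (U θ)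

/-- The seminorm `‖θ‖_U = √⟨θ, U θ⟩`. -/
def opNorm {H : Type*} [NormedAddCommGroup H] [InnerProductSpace ℝ H] (U : H →L[ℝ] H) (θ : H) : ℝ :=
  Real.sqrt ⟪θ, U θ⟫_ℝ

/-- The smallest `N` such that all eigenvalues after the first `N` are below the threshold `c`. -/
def truncIndex (lam : ℕ → ℝ) (c : ℝ) : ℕ := sInf {N | ∀ i ≥ N, lam i < c}

/-- The pseudo-inverse `θ ↦ ∑_{i ≤ N} lamᵢ⁻¹ ⟨θ, eᵢ⟩ eᵢ` of the operator truncated after its first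
`N` eigenvalues. -/
def truncPinv {H : Type*} [NormedAddCommGroup H] [InnerProductSpace ℝ H]
    (lam : ℕ → ℝ) (e : ℕ → H) (N : ℕ) (θ : H) : H :=
  ∑ i ∈ Finset.range N, ((1 / lam i) * ⟪θ, e i⟫_ℝ) • e i

/-- The truncation level `ε* = n^{-2/(γ+2)}`. -/
def epsStar (γ : ℝ) (n : ℕ) : ℝ := (n : ℝ) ^ (-2 / (γ + 2))

/-- `N_{ε*}`, the number of retained eigenvalues: the threshold is `n ε*`. -/
def numRetained (γ : ℝ) (n : ℕ) (lam : ℕ → ℝ) : ℕ := truncIndex lam (n * epsStar γ n)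

/-- `p` is a projection of `θ` onto the set `C` in the seminorm `‖·‖_U`: a minimizer over `z ∈ C` of
`‖z - θ‖_U²`. -/
def IsOpProjection {H : Type*} [NormedAddCommGroup H] [InnerProductSpace ℝ H]
    (U : H →L[ℝ] H) (C : Set H) (θ p : H) : Prop :=
  p ∈ C ∧ IsMinOn (fun z => opNorm U (z - θ) ^ 2) C p

/-- `θhat` is an output of the regression oracle on the data `(xⱼ, aⱼ, yⱼ)`, run with parameters
`γ`, `M` and the spectral decomposition `(lam, e)` of the design operator `U_D`: it is a
`U_D`-projection onto `C` of the pseudo-inverse of the operator truncated at `N_{ε*}`, applied to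
the response. -/
def Model.IsOracleOutput (Q : Model 𝒳 𝒜 d) {n : ℕ} (γ M : ℝ) (x : Fin n → 𝒳) (a : Fin n → 𝒜)
    (lam : ℕ → ℝ) (e : ℕ → Q.H) (y : Fin n → ℝ) (θhat : Q.H) : Prop :=
  IsOpProjection (Q.designOp x a) (Q.coeffSet M)
    (truncPinv lam e (numRetained γ n lam) (Q.response x a y)) θhat

/-- The responses of a fixed design `(xⱼ, aⱼ)`: independent `S`-valued random variables `yⱼ`, where
`yⱼ` has distribution function `s ↦ F_θ(xⱼ, aⱼ, s)`. -/
structure Model.IsSample (Q : Model 𝒳 𝒜 d) {Γ : Type*} [MeasurableSpace Γ] (μ : Measure Γ)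
    (θ : Q.H) {n : ℕ} (x : Fin n → 𝒳) (a : Fin n → 𝒜) (y : Fin n → Γ → ℝ) : Prop where
  measurable : ∀ j, Measurable (y j)
  indep : iIndepFun y μ
  mem_S : ∀ j, ∀ᵐ ω ∂μ, y j ω ∈ Q.S
  cdf_eq : ∀ j, ∀ s ∈ Q.S, μ.real {ω | y j ω ≤ s} = Q.mixture θ (x j) (a j) s

end FunctionalRegression

end

/-!
The error of the oracle splits into a variance part, controlled by a self-normalized deviation
inequality, and a bias part, controlled by the truncation threshold `c = n ε*`, which equals
`n ^ (γ / (γ + 2)) ≥ 1`.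

Write `U` for the design operator and `ξ = response - U θ*` for the noise.

* The set `C` is convex and contains `θ*`, so projecting onto it in the seminorm `‖·‖_U` does not
  increase the distance to `θ*` (`opNorm_projection_sub_le`). It remains to bound the error of the
  truncated pseudo-inverse. In the eigenbasis its square is at most
  `∑_{i < N} ⟨ξ, eᵢ⟩² / lamᵢ + c ‖θ*‖²` (`inner_truncPinv_sub_le`): a discarded eigenvalue is less
  than `c`. As `1 ≤ c`, the square root of the second term is at most `c M`.
* By Fubini, `⟨θ, U θ⟩ = ∑ⱼ ∫_S F_θ(xⱼ, aⱼ, s)² dm(s)`, and `⟨θ, ξ⟩` is a sum of independent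
  centred bounded variables. Hoeffding's lemma and the Cauchy-Schwarz inequality then give
  `E exp ⟨θ, ξ⟩ ≤ exp (⟨θ, U θ⟩ / 2)` for every `θ` (`IsSample.lintegral_exp_inner_le`).
* Averaging this bound over Gaussian combinations `θ` of the first `N` eigenvectors gives
  `E exp (∑_{i < N} ⟨ξ, eᵢ⟩² / (2 (1 + lamᵢ))) ≤ ∏_{i < N} √(1 + lamᵢ)`
  (`lintegral_exp_sum_sq_le`), and Markov's inequality turns it into a bound on
  `∑_{i < N} ⟨ξ, eᵢ⟩² / (1 + lamᵢ)` that holds with probability at least `1 - δ`.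
* The retained eigenvalues are at least `c ≥ 1`, so `1 / lamᵢ ≤ 2 / (1 + lamᵢ)`. This is the source
  of the outer factor `2` under the square root.

The oracle output need not depend measurably on the sample: the deviation inequality defines a
measurable event, and this event is contained in the one of the theorem.
-/

namespace FunctionalRegression

/-! ### The seminorm of an operator with a spectral decomposition -/

section Spectral

variable {H : Type*} [NormedAddCommGroup H] [InnerProductSpace ℝ H] {U : H →L[ℝ] H}
  {lam : ℕ → ℝ} {e : ℕ → H}

namespace IsSpectralDecomposition

theorem eigenvalue_nonneg (h : IsSpectralDecomposition U lam e) (i : ℕ) : 0 ≤ lam i :=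
  h.antitone.le_of_tendsto h.tendsto_zero i

theorem hasSum_inner (h : IsSpectralDecomposition U lam e) (θ η : H) :
    HasSum (fun i => lam i * ⟪η, e i⟫_ℝ * ⟪θ, e i⟫_ℝ) ⟪θ, U η⟫_ℝ := by
  simpa [real_inner_smul_right] using (innerSL ℝ θ).hasSum (h.hasSum η)

theorem inner_apply_comm (h : IsSpectralDecomposition U lam e) (θ η : H) :
    ⟪θ, U η⟫_ℝ = ⟪η, U θ⟫_ℝ := by
  refine (h.hasSum_inner θ η).unique ?_
  convert! h.hasSum_inner η θ using 2
  ring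

theorem inner_apply_self_nonneg (h : IsSpectralDecomposition U lam e) (θ : H) :
    0 ≤ ⟪θ, U θ⟫_ℝ :=
  (h.hasSum_inner θ θ).nonneg fun i => by
    rw [mul_assoc]
    exact mul_nonneg (h.eigenvalue_nonneg i) (mul_self_nonneg _)

theorem inner_eigenvector (h : IsSpectralDecomposition U lam e) {i k : ℕ} (hi : lam i ≠ 0)
    (hk : lam k ≠ 0) : ⟪e i, e k⟫_ℝ = if i = k then 1 else 0 := by
  have := orthonormal_iff_ite.1 h.orthonormal ⟨i, hi⟩ ⟨k, hk⟩
  simpa using this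

theorem inner_apply_eigenvector (h : IsSpectralDecomposition U lam e) {k : ℕ} (hk : lam k ≠ 0)
    (θ : H) : ⟪U θ, e k⟫_ℝ = lam k * ⟪θ, e k⟫_ℝ := by
  rw [real_inner_comm]
  refine (h.hasSum_inner (e k) θ).unique ?_
  convert! hasSum_single (f := fun i => lam i * ⟪θ, e i⟫_ℝ * ⟪e k, e i⟫_ℝ) k ?_ using 1
  · rw [h.inner_eigenvector hk hk, if_pos rfl, mul_one]
  · intro i hik
    by_cases hi : lam i = 0
    · simp [hi]
    · simp [h.inner_eigenvector hk hi, hik.symm]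

/-- The quadratic form of `U` is diagonal on combinations of eigenvectors of nonzero
eigenvalues. -/
theorem inner_apply_sum_self (h : IsSpectralDecomposition U lam e) {N : ℕ}
    (hN : ∀ i : Fin N, lam i ≠ 0) (t : Fin N → ℝ) :
    ⟪∑ i : Fin N, t i • e i, U (∑ i : Fin N, t i • e i)⟫_ℝ = ∑ i : Fin N, lam i * t i ^ 2 := by
  rw [real_inner_comm, inner_sum]
  refine Finset.sum_congr rfl fun k _ => ?_
  have hcoord : ⟪∑ i : Fin N, t i • e i, e k⟫_ℝ = t k := by
    rw [sum_inner]
    have : ∀ i : Fin N, ⟪t i • e i, e k⟫_ℝ = if i = k then t i else 0 := fun i => by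
      rw [real_inner_smul_left, h.inner_eigenvector (hN i) (hN k)]
      simp [Fin.ext_iff]
    simp [this]
  rw [real_inner_smul_right, h.inner_apply_eigenvector (hN k), hcoord]
  ring

theorem le_eigenvalue_of_lt_truncIndex (h : IsSpectralDecomposition U lam e) {c : ℝ} {i : ℕ}
    (hi : i < truncIndex lam c) : c ≤ lam i := by
  by_contra! hc
  exact Nat.notMem_of_lt_sInf hi fun j hj => (h.antitone hj).trans_lt hc

theorem eigenvalue_lt_of_truncIndex_le (h : IsSpectralDecomposition U lam e) {c : ℝ}
    (hc : 0 < c) {i : ℕ} (hi : truncIndex lam c ≤ i) : lam i < c := by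
  have hne : {N | ∀ i ≥ N, lam i < c}.Nonempty :=
    eventually_atTop.1 (h.tendsto_zero.eventually_lt_const hc)
  exact Nat.sInf_mem hne i hi

theorem inner_truncPinv (h : IsSpectralDecomposition U lam e) {N : ℕ}
    (hN : ∀ i < N, lam i ≠ 0) (g : H) {k : ℕ} (hk : lam k ≠ 0) :
    ⟪truncPinv lam e N g, e k⟫_ℝ = if k < N then 1 / lam k * ⟪g, e k⟫_ℝ else 0 := by
  rw [truncPinv, sum_inner]
  have : ∀ i ∈ Finset.range N, ⟪((1 / lam i) * ⟪g, e i⟫_ℝ) • e i, e k⟫_ℝ =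
      if i = k then 1 / lam i * ⟪g, e i⟫_ℝ else 0 := fun i hi => by
    rw [real_inner_smul_left, h.inner_eigenvector (hN i (Finset.mem_range.1 hi)) hk]
    simp
  rw [Finset.sum_congr rfl this, Finset.sum_ite_eq']
  simp

/-- Bessel's inequality for the eigenvectors of nonzero eigenvalues. -/
theorem sum_inner_sq_le (h : IsSpectralDecomposition U lam e) (θ : H) (s : Finset ℕ) :
    ∑ i ∈ s, (if lam i ≠ 0 then ⟪θ, e i⟫_ℝ ^ 2 else 0) ≤ ‖θ‖ ^ 2 := by
  have := h.orthonormal.sum_inner_products_le (x := θ) (s := s.subtype fun i => lam i ≠ 0)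
  rw [← Finset.sum_filter, ← Finset.sum_subtype_eq_sum_filter]
  refine le_trans (le_of_eq (Finset.sum_congr rfl fun i _ => ?_)) this
  rw [Real.norm_eq_abs, sq_abs, real_inner_comm]

/-- Bias-variance bound for the truncated pseudo-inverse: retained directions contribute the
noise `g - U θ` weighted by `1 / lam i`, the discarded ones at most `c ‖θ‖²`. -/
theorem inner_truncPinv_sub_le (h : IsSpectralDecomposition U lam e) {c : ℝ} (hc : 0 < c)
    (g θ : H) :
    ⟪truncPinv lam e (truncIndex lam c) g - θ, U (truncPinv lam e (truncIndex lam c) g - θ)⟫_ℝ ≤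
      ∑ i ∈ Finset.range (truncIndex lam c), ⟪g - U θ, e i⟫_ℝ ^ 2 / lam i + c * ‖θ‖ ^ 2 := by
  set N := truncIndex lam c
  have hN : ∀ i < N, 0 < lam i := fun i hi => hc.trans_le (h.le_eigenvalue_of_lt_truncIndex hi)
  refine hasSum_le_of_sum_le (h.hasSum_inner _ _) fun s => ?_
  have hterm : ∀ i, lam i * ⟪truncPinv lam e N g - θ, e i⟫_ℝ * ⟪truncPinv lam e N g - θ, e i⟫_ℝ ≤
      (if i ∈ Finset.range N then ⟪g - U θ, e i⟫_ℝ ^ 2 / lam i else 0) +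
        c * (if lam i ≠ 0 then ⟪θ, e i⟫_ℝ ^ 2 else 0) := by
    intro i
    by_cases hi : i < N
    · have hpos := hN i hi
      rw [inner_sub_left, h.inner_truncPinv (fun i hi => (hN i hi).ne') g hpos.ne', inner_sub_left,
        h.inner_apply_eigenvector hpos.ne', if_pos hi, if_pos (Finset.mem_range.2 hi),
        if_pos hpos.ne']
      refine le_add_of_le_of_nonneg (le_of_eq ?_) (by positivity)
      field_simp
    · by_cases h0 : lam i = 0
      · simp [h0]
      · rw [inner_sub_left, h.inner_truncPinv (fun i hi => (hN i hi).ne') g h0, if_neg hi,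
          if_neg (by simpa using hi), if_pos h0]
        have := (h.eigenvalue_lt_of_truncIndex_le hc (not_lt.1 hi)).le
        nlinarith [mul_le_mul_of_nonneg_right this (sq_nonneg ⟪θ, e i⟫_ℝ)]
  refine (Finset.sum_le_sum fun i _ => hterm i).trans ?_
  rw [Finset.sum_add_distrib, ← Finset.mul_sum]
  refine add_le_add ?_ (mul_le_mul_of_nonneg_left (h.sum_inner_sq_le θ s) hc.le)
  rw [Finset.sum_ite_mem]
  refine Finset.sum_le_sum_of_subset_of_nonneg Finset.inter_subset_right fun i hi _ => ?_
  exact div_nonneg (sq_nonneg _) (hN i (Finset.mem_range.1 hi)).le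

/-- A projection onto a convex set in the seminorm `‖·‖_U` does not increase the distance to the
points of the set. -/
theorem opNorm_projection_sub_le (h : IsSpectralDecomposition U lam e) {C : Set H}
    (hC : Convex ℝ C) {θ p z : H} (hp : IsOpProjection U C θ p) (hz : z ∈ C) :
    opNorm U (p - z) ≤ opNorm U (θ - z) := by
  have hsq : ∀ u, opNorm U u ^ 2 = ⟪u, U u⟫_ℝ := fun u =>
    Real.sq_sqrt (h.inner_apply_self_nonneg u)
  have hadd : ∀ u v, ⟪u + v, U (u + v)⟫_ℝ = ⟪u, U u⟫_ℝ + 2 * ⟪u, U v⟫_ℝ + ⟪v, U v⟫_ℝ := by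
    intro u v
    simp only [map_add, inner_add_left, inner_add_right]
    rw [h.inner_apply_comm v u]; ring
  -- moving from `p` towards `z` gives a nonnegative difference quotient at every `t ∈ (0, 1]`
  have hvar : ∀ t : ℝ, 0 < t → t ≤ 1 →
      0 ≤ 2 * ⟪p - θ, U (z - p)⟫_ℝ + t * ⟪z - p, U (z - p)⟫_ℝ := by
    intro t ht ht1
    have hmem : p + t • (z - p) ∈ C := hC.add_smul_sub_mem hp.1 hz ⟨ht.le, ht1⟩
    have hmin := isMinOn_iff.1 hp.2 _ hmem
    simp only [hsq] at hmin
    rw [show p + t • (z - p) - θ = (p - θ) + t • (z - p) by abel, hadd] at hmin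
    simp only [map_smul, real_inner_smul_left, real_inner_smul_right] at hmin
    refine nonneg_of_mul_nonneg_right (a := t) ?_ ht
    nlinarith
  have hlim : Tendsto (fun t : ℝ => 2 * ⟪p - θ, U (z - p)⟫_ℝ + t * ⟪z - p, U (z - p)⟫_ℝ)
      (𝓝[>] 0) (𝓝 (2 * ⟪p - θ, U (z - p)⟫_ℝ + 0 * ⟪z - p, U (z - p)⟫_ℝ)) :=
    tendsto_nhdsWithin_of_tendsto_nhds
      (Continuous.tendsto (by fun_prop : Continuous fun t : ℝ =>
        2 * ⟪p - θ, U (z - p)⟫_ℝ + t * ⟪z - p, U (z - p)⟫_ℝ) 0)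
  have hopt := ge_of_tendsto hlim (by
    filter_upwards [Ioc_mem_nhdsGT (zero_lt_one' ℝ)] with t ht using hvar t ht.1 ht.2)
  have hcross : ⟪θ - p, U (p - z)⟫_ℝ = ⟪p - θ, U (z - p)⟫_ℝ := by
    rw [← neg_sub p θ, ← neg_sub z p, map_neg, inner_neg_neg]
  refine Real.sqrt_le_sqrt ?_
  rw [← sub_add_sub_cancel θ p z, hadd, hcross]
  linarith [h.inner_apply_self_nonneg (θ - p)]

end IsSpectralDecomposition

end Spectral

end FunctionalRegression

namespace FunctionalRegression

/-! ### The method of mixtures -/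

section Mixture

theorem integral_exp_mul_sq_gaussianReal {l : ℝ} (hl : 0 ≤ l) :
    Integrable (fun t : ℝ => Real.exp (l * t ^ 2 / 2)) (gaussianReal 0 (Real.toNNReal (1 + l)⁻¹)) ∧
    ∫ t, Real.exp (l * t ^ 2 / 2) ∂(gaussianReal 0 (Real.toNNReal (1 + l)⁻¹)) =
      Real.sqrt (1 + l) := by
  have hv : 0 < (1 + l)⁻¹ := by positivity
  have hv0 : Real.toNNReal (1 + l)⁻¹ ≠ 0 := by simpa using hv
  have hpdf : ∀ t : ℝ, gaussianPDFReal 0 (Real.toNNReal (1 + l)⁻¹) t * Real.exp (l * t ^ 2 / 2) =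
      (Real.sqrt (2 * Real.pi * (1 + l)⁻¹))⁻¹ * Real.exp (-(1 / 2) * t ^ 2) := by
    intro t
    rw [gaussianPDFReal, Real.coe_toNNReal _ hv.le, mul_assoc, ← Real.exp_add]
    congr 2
    field_simp
    ring
  constructor
  · rw [gaussianReal_of_var_ne_zero _ hv0,
      integrable_withDensity_iff (measurable_gaussianPDF _ _) (by simp [gaussianPDF])]
    simp only [gaussianPDF, ENNReal.toReal_ofReal (gaussianPDFReal_nonneg _ _ _)]
    simp only [mul_comm (Real.exp _), hpdf]
    exact (integrable_exp_neg_mul_sq (by norm_num)).const_mul _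
  · rw [integral_gaussianReal_eq_integral_smul hv0]
    simp only [smul_eq_mul, hpdf]
    rw [integral_const_mul, integral_gaussian, ← Real.sqrt_inv, ← Real.sqrt_mul (by positivity)]
    congr 1
    field_simp

/-- If the vector `ξ` is sub-Gaussian with a diagonal variance proxy `lam`, integrating its
exponential moments against the Gaussian law with variances `(1 + lam i)⁻¹` bounds the exponential
moment of a quadratic form of `ξ`. -/
theorem lintegral_exp_sum_sq_le {Γ : Type*} [MeasurableSpace Γ] (μ : Measure Γ)
    [IsProbabilityMeasure μ] {ι : Type*} [Fintype ι] {ξ : ι → Γ → ℝ}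
    (hξ : ∀ i, Measurable (ξ i)) {lam : ι → ℝ} (hlam : ∀ i, 0 ≤ lam i)
    (hsub : ∀ t : ι → ℝ, ∫⁻ ω, ENNReal.ofReal (Real.exp (∑ i, t i * ξ i ω)) ∂μ ≤
      ENNReal.ofReal (Real.exp (∑ i, lam i * t i ^ 2 / 2))) :
    ∫⁻ ω, ENNReal.ofReal (Real.exp (∑ i, ξ i ω ^ 2 / (2 * (1 + lam i)))) ∂μ ≤
      ENNReal.ofReal (∏ i, Real.sqrt (1 + lam i)) := by
  set ρ : ι → Measure ℝ := fun i => gaussianReal 0 (Real.toNNReal (1 + lam i)⁻¹)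
  have hmgf : ∀ ω, ENNReal.ofReal (Real.exp (∑ i, ξ i ω ^ 2 / (2 * (1 + lam i)))) =
      ∫⁻ t, ENNReal.ofReal (Real.exp (∑ i, t i * ξ i ω)) ∂(Measure.pi ρ) := by
    intro ω
    simp only [Real.exp_sum]
    rw [← ofReal_integral_eq_lintegral_ofReal, integral_fintype_prod_eq_prod
      (f := fun i (r : ℝ) => Real.exp (r * ξ i ω))]
    · congr 1
      refine Finset.prod_congr rfl fun i _ => ?_
      have hv : 0 < (1 + lam i)⁻¹ := by have := hlam i; positivity
      have := congrFun (mgf_id_gaussianReal (μ := 0) (v := Real.toNNReal (1 + lam i)⁻¹)) (ξ i ω)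
      simp only [mgf, id, Real.coe_toNNReal _ hv.le] at this
      simp only [mul_comm (ξ i ω)] at this
      rw [this]
      congr 1
      have := hlam i
      field_simp
      ring
    · refine Integrable.fintype_prod (f := fun i (r : ℝ) => Real.exp (r * ξ i ω)) fun i => ?_
      simpa only [mul_comm] using
        integrable_exp_mul_gaussianReal (μ := 0) (v := Real.toNNReal (1 + lam i)⁻¹) (ξ i ω)
    · exact ae_of_all _ fun t => Finset.prod_nonneg fun i _ => (Real.exp_pos _).le
  simp only [hmgf]
  rw [lintegral_lintegral_swap (by fun_prop)]
  refine (lintegral_mono hsub).trans (le_of_eq ?_)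
  simp only [Real.exp_sum]
  rw [← ofReal_integral_eq_lintegral_ofReal, integral_fintype_prod_eq_prod
    (f := fun i (r : ℝ) => Real.exp (lam i * r ^ 2 / 2))]
  · congr 1
    exact Finset.prod_congr rfl fun i _ => (integral_exp_mul_sq_gaussianReal (hlam i)).2
  · exact Integrable.fintype_prod (f := fun i (r : ℝ) => Real.exp (lam i * r ^ 2 / 2))
      fun i => (integral_exp_mul_sq_gaussianReal (hlam i)).1
  · exact ae_of_all _ fun t => Finset.prod_nonneg fun i _ => (Real.exp_pos _).le

/-- Self-normalized deviation inequality for a sub-Gaussian vector with diagonal variance proxy. -/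
theorem measureReal_sum_sq_le {Γ : Type*} [MeasurableSpace Γ] (μ : Measure Γ)
    [IsProbabilityMeasure μ] {ι : Type*} [Fintype ι] {ξ : ι → Γ → ℝ}
    (hξ : ∀ i, Measurable (ξ i)) {lam : ι → ℝ} (hlam : ∀ i, 0 ≤ lam i)
    (hsub : ∀ t : ι → ℝ, ∫⁻ ω, ENNReal.ofReal (Real.exp (∑ i, t i * ξ i ω)) ∂μ ≤
      ENNReal.ofReal (Real.exp (∑ i, lam i * t i ^ 2 / 2))) {δ : ℝ} (hδ : 0 < δ) :
    1 - δ ≤ μ.real {ω | ∑ i, ξ i ω ^ 2 / (1 + lam i) ≤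
      2 * Real.log (1 / δ) + ∑ i, Real.log (1 + lam i)} := by
  set A : Set Γ := {ω | ∑ i, ξ i ω ^ 2 / (1 + lam i) ≤
      2 * Real.log (1 / δ) + ∑ i, Real.log (1 + lam i)}
  have hA : MeasurableSet A := measurableSet_le (by fun_prop) measurable_const
  have h1 : ∀ i, 0 < 1 + lam i := fun i => by have := hlam i; positivity
  set R := ∏ i, Real.sqrt (1 + lam i)
  have hR : 0 < R := Finset.prod_pos fun i _ => Real.sqrt_pos.2 (h1 i)
  have hlogR : Real.log R = ∑ i, Real.log (1 + lam i) / 2 := by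
    rw [Real.log_prod fun i _ => (Real.sqrt_pos.2 (h1 i)).ne']
    exact Finset.sum_congr rfl fun i _ => Real.log_sqrt (h1 i).le
  have hmarkov := mul_meas_ge_le_lintegral (μ := μ)
    (f := fun ω => ENNReal.ofReal (Real.exp (∑ i, ξ i ω ^ 2 / (2 * (1 + lam i)))))
    (by fun_prop) (ENNReal.ofReal (R / δ))
  have hsubset : Aᶜ ⊆ {ω | ENNReal.ofReal (R / δ) ≤
      ENNReal.ofReal (Real.exp (∑ i, ξ i ω ^ 2 / (2 * (1 + lam i))))} := by
    intro ω hω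
    have hω' : 2 * Real.log (1 / δ) + ∑ i, Real.log (1 + lam i) <
        ∑ i, ξ i ω ^ 2 / (1 + lam i) := not_le.1 hω
    refine ENNReal.ofReal_le_ofReal ?_
    rw [← Real.log_le_iff_le_exp (by positivity), Real.log_div hR.ne' hδ.ne', hlogR,
      ← Finset.sum_div]
    have : ∑ i, ξ i ω ^ 2 / (2 * (1 + lam i)) = (∑ i, ξ i ω ^ 2 / (1 + lam i)) / 2 := by
      rw [Finset.sum_div]
      refine Finset.sum_congr rfl fun i _ => ?_
      rw [div_div, mul_comm 2]
    rw [this]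
    rw [one_div, Real.log_inv] at hω'
    linarith
  have hle : ENNReal.ofReal (R / δ) * μ Aᶜ ≤ ENNReal.ofReal R :=
    (mul_le_mul_right (measure_mono hsubset) _).trans
      (hmarkov.trans (lintegral_exp_sum_sq_le μ hξ hlam hsub))
  rw [← ofReal_measureReal, ← ENNReal.ofReal_mul (by positivity),
    ENNReal.ofReal_le_ofReal_iff hR.le, probReal_compl_eq_one_sub hA, div_mul_eq_mul_div,
    div_le_iff₀ hδ] at hle
  linarith [le_of_mul_le_mul_left hle hR]

end Mixture

end FunctionalRegression

namespace FunctionalRegression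

/-! ### The design operator and the response in terms of mixtures -/

namespace Model

variable {𝒳 𝒜 : Type*} {d : ℕ} (Q : Model 𝒳 𝒜 d)

theorem convex_coeffSet (M : ℝ) : Convex ℝ (Q.coeffSet M) := by
  rintro θ ⟨hθ0, hθ1, hθM⟩ η ⟨hη0, hη1, hηM⟩ s t hs ht hst
  have hcoe : (s • θ + t • η : Q.H) =ᵐ[Q.ν] fun w => s * θ w + t * η w := by
    filter_upwards [Lp.coeFn_add (s • θ) (t • η), Lp.coeFn_smul s θ, Lp.coeFn_smul t η]
      with w h h1 h2
    rw [h, Pi.add_apply, h1, h2]; rfl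
  refine ⟨?_, ?_, (convexOn_norm convex_univ).2 trivial trivial hs ht hst |>.trans ?_⟩
  · filter_upwards [hcoe, hθ0, hη0] with w hw h1 h2
    rw [hw]
    exact add_nonneg (mul_nonneg hs h1) (mul_nonneg ht h2)
  · rw [integral_congr_ae hcoe, integral_add ((Q.integrable_H θ).const_mul s)
      ((Q.integrable_H η).const_mul t), integral_const_mul, integral_const_mul, hθ1, hη1,
      mul_one, mul_one, hst]
  · calc s • ‖θ‖ + t • ‖η‖ ≤ s • M + t • M := by
          simp only [smul_eq_mul]; gcongr
      _ = M := by rw [← add_smul, hst, one_smul]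

theorem inner_eq_integral (θ η : Q.H) : ⟪θ, η⟫_ℝ = ∫ w, θ w * η w ∂Q.ν := by
  rw [L2.inner_def]
  exact integral_congr_ae (ae_of_all _ fun w => by simp [mul_comm])

theorem stronglyMeasurable_mixture (θ : Q.H) (x : 𝒳) (a : 𝒜) :
    StronglyMeasurable (Q.mixture θ x a) := by
  obtain ⟨g, hg, hgθ⟩ := Lp.aestronglyMeasurable θ
  have : Q.mixture θ x a = fun s => ∫ w, g w * Q.φ₀ x a (w, s) ∂Q.ν := by
    ext s
    refine integral_congr_ae ?_
    filter_upwards [Q.ae_mem_Ω, hgθ] with w hw h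
    rw [h, Q.φ₀_eq x a hw]
  rw [this]
  exact StronglyMeasurable.integral_prod_right (f := fun s w => g w * Q.φ₀ x a (w, s))
    ((hg.comp_measurable measurable_snd).mul
      ((Q.measurable_φ₀ x a).comp measurable_swap).stronglyMeasurable)

theorem norm_mixture_le (θ : Q.H) (x : 𝒳) (a : 𝒜) (s : ℝ) : ‖Q.mixture θ x a s‖ ≤ ‖θ‖ := by
  refine (norm_integral_le_of_norm_le (Q.integrable_H θ).norm ?_).trans (Q.integral_norm_le θ)
  filter_upwards [Q.ae_mem_Ω] with w hw
  rw [norm_mul, Real.norm_of_nonneg (Q.φ_nonneg x a hw s)]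
  exact mul_le_of_le_one_right (norm_nonneg _) (Q.φ_le_one x a hw s)

theorem memLp_mixture (θ : Q.H) (x : 𝒳) (a : 𝒜) (p : ENNReal) :
    MemLp (Q.mixture θ x a) p Q.mS :=
  MemLp.of_bound (Q.stronglyMeasurable_mixture θ x a).aestronglyMeasurable ‖θ‖
    (ae_of_all _ (Q.norm_mixture_le θ x a))

theorem integrable_mixture (θ : Q.H) (x : 𝒳) (a : 𝒜) : Integrable (Q.mixture θ x a) Q.mS :=
  memLp_one_iff_integrable.1 (Q.memLp_mixture θ x a 1)

/-- Fubini's theorem: pairing `θ` with the `S`-average of `f s φ(x, a, ·, s)`. -/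
theorem integral_mul_integral_φ (θ : Q.H) (x : 𝒳) (a : 𝒜) {f : ℝ → ℝ} (hf : Integrable f Q.mS) :
    ∫ w, θ w * ∫ s, f s * Q.φ x a w s ∂Q.mS ∂Q.ν = ∫ s, f s * Q.mixture θ x a s ∂Q.mS := by
  have hint : Integrable (Function.uncurry fun w s => θ w * (f s * Q.φ₀ x a (w, s)))
      (Q.ν.prod Q.mS) := by
    have := ((Q.integrable_H θ).mul_prod hf).mul_bdd (c := 1)
      (Q.measurable_φ₀ x a).aestronglyMeasurable (ae_of_all _ (Q.norm_φ₀_le x a))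
    simpa only [mul_assoc, Function.uncurry_def] using this
  calc ∫ w, θ w * ∫ s, f s * Q.φ x a w s ∂Q.mS ∂Q.ν
      = ∫ w, ∫ s, θ w * (f s * Q.φ₀ x a (w, s)) ∂Q.mS ∂Q.ν := by
        refine integral_congr_ae ?_
        filter_upwards [Q.ae_mem_Ω] with w hw
        simp only [Q.φ₀_eq x a hw, integral_const_mul]
    _ = ∫ s, ∫ w, θ w * (f s * Q.φ₀ x a (w, s)) ∂Q.ν ∂Q.mS := integral_integral_swap hint
    _ = ∫ s, f s * Q.mixture θ x a s ∂Q.mS := by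
        refine integral_congr_ae (ae_of_all _ fun s => ?_)
        simp only [mixture, ← integral_const_mul]
        refine integral_congr_ae ?_
        filter_upwards [Q.ae_mem_Ω] with w hw
        rw [Q.φ₀_eq x a hw]; ring

theorem intOpFun_eq (x : 𝒳) (a : 𝒜) (θ : Q.H) {w : EuclideanSpace ℝ (Fin d)} (hw : w ∈ Q.Ω) :
    Q.intOpFun x a θ w = ∫ s, Q.mixture θ x a s * Q.φ x a w s ∂Q.mS := by
  have hf : Integrable (fun s => Q.φ x a w s) Q.mS := by
    refine Integrable.of_bound ?_ 1 (ae_of_all _ fun s => ?_)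
    · have : (fun s => Q.φ x a w s) = fun s => Q.φ₀ x a (w, s) :=
        funext fun s => (Q.φ₀_eq x a hw s).symm
      rw [this]
      exact ((Q.measurable_φ₀ x a).comp measurable_prodMk_left).aestronglyMeasurable
    · rw [Real.norm_of_nonneg (Q.φ_nonneg x a hw s)]
      exact Q.φ_le_one x a hw s
  rw [intOpFun]
  simp only [kernel]
  rw [Q.integral_mul_integral_φ θ x a hf]
  simp only [mul_comm]

section Design

variable {n : ℕ} (x : Fin n → 𝒳) (a : Fin n → 𝒜)

theorem inner_designOp (θ η : Q.H) :
    ⟪θ, Q.designOp x a η⟫_ℝ =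
      ∑ j, ∫ s, Q.mixture η (x j) (a j) s * Q.mixture θ (x j) (a j) s ∂Q.mS := by
  rw [designOp, sum_apply, inner_sum]
  refine Finset.sum_congr rfl fun j _ => ?_
  rw [inner_eq_integral, ← Q.integral_mul_integral_φ θ _ _ (Q.integrable_mixture η _ _)]
  refine integral_congr_ae ?_
  filter_upwards [Q.intOp_apply_ae (x j) (a j) η, Q.ae_mem_Ω] with w h hw
  rw [h, Q.intOpFun_eq _ _ _ hw]

theorem integrable_indicator_Ici (t : ℝ) :
    Integrable ((Set.Ici t).indicator fun _ => (1 : ℝ)) Q.mS :=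
  (integrable_const 1).indicator measurableSet_Ici

theorem inner_response (θ : Q.H) (y : Fin n → ℝ) :
    ⟪θ, Q.response x a y⟫_ℝ = ∑ j, ∫ s, (Set.Ici (y j)).indicator (fun _ => (1 : ℝ)) s *
      Q.mixture θ (x j) (a j) s ∂Q.mS := by
  have hint : ∀ j, ∀ w ∈ Q.Ω, Integrable (fun s =>
      (Set.Ici (y j)).indicator (fun _ => (1 : ℝ)) s * Q.φ (x j) (a j) w s) Q.mS := by
    intro j w hw
    simp only [← Q.φ₀_eq (x j) (a j) hw]
    exact (Q.integrable_indicator_Ici (y j)).mul_bdd (c := 1)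
      ((Q.measurable_φ₀ _ _).comp measurable_prodMk_left).aestronglyMeasurable
      (ae_of_all _ fun s => Q.norm_φ₀_le _ _ _)
  have hmem : ∀ j, MemLp (fun w => ∫ s, (Set.Ici (y j)).indicator (fun _ => (1 : ℝ)) s *
      Q.φ (x j) (a j) w s ∂Q.mS) 2 Q.ν := by
    intro j
    have := Q.memLp_responseFun (fun _ : Fin 1 => x j) (fun _ => a j) (fun _ => y j)
    refine this.ae_eq (ae_of_all _ fun w => ?_)
    simp [responseFun]
  have hsum : ∀ᵐ w ∂Q.ν, Q.response x a y w = ∑ j, ∫ s,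
      (Set.Ici (y j)).indicator (fun _ => (1 : ℝ)) s * Q.φ (x j) (a j) w s ∂Q.mS := by
    filter_upwards [(Q.memLp_responseFun x a y).coeFn_toLp, Q.ae_mem_Ω] with w h hw
    rw [response, h, responseFun, integral_finsetSum _ fun j _ => hint j w hw]
  rw [inner_eq_integral]
  calc ∫ w, θ w * Q.response x a y w ∂Q.ν
      = ∫ w, ∑ j, θ w * ∫ s, (Set.Ici (y j)).indicator (fun _ => (1 : ℝ)) s *
          Q.φ (x j) (a j) w s ∂Q.mS ∂Q.ν := by
        refine integral_congr_ae ?_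
        filter_upwards [hsum] with w h
        rw [h, Finset.mul_sum]
    _ = _ := by
        have hmul : ∀ j ∈ Finset.univ, Integrable (fun w => θ w * ∫ s,
            (Set.Ici (y j)).indicator (fun _ => (1 : ℝ)) s * Q.φ (x j) (a j) w s ∂Q.mS) Q.ν :=
          fun j _ => (Lp.memLp θ).integrable_mul (hmem j)
        rw [integral_finsetSum _ hmul]
        exact Finset.sum_congr rfl fun j _ =>
          Q.integral_mul_integral_φ θ _ _ (Q.integrable_indicator_Ici (y j))

end Design

/-! ### Sub-Gaussianity of the noise -/

/-- The contribution `∫_S 𝟙{t ≤ s} F_θ(x, a, s) dm(s)` of a response `t` to the pairing of `θ`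
with the response function. -/
noncomputable def tailMixture (θ : Q.H) (x : 𝒳) (a : 𝒜) (t : ℝ) : ℝ :=
  ∫ s, (Set.Ici t).indicator (fun _ => (1 : ℝ)) s * Q.mixture θ x a s ∂Q.mS

theorem measurable_indicator_Ici_uncurry :
    Measurable fun p : ℝ × ℝ => (Set.Ici p.1).indicator (fun _ => (1 : ℝ)) p.2 := by
  have : (fun p : ℝ × ℝ => (Set.Ici p.1).indicator (fun _ => (1 : ℝ)) p.2) =
      {p : ℝ × ℝ | p.1 ≤ p.2}.indicator fun _ => 1 := by
    ext p; simp [Set.indicator]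
  rw [this]
  exact measurable_const.indicator (measurableSet_le measurable_fst measurable_snd)

theorem measurable_tailMixture (θ : Q.H) (x : 𝒳) (a : 𝒜) : Measurable (Q.tailMixture θ x a) :=
  (StronglyMeasurable.integral_prod_right
    (f := fun t s => (Set.Ici t).indicator (fun _ => (1 : ℝ)) s * Q.mixture θ x a s)
    (measurable_indicator_Ici_uncurry.mul
      ((Q.stronglyMeasurable_mixture θ x a).measurable.comp
        measurable_snd)).stronglyMeasurable).measurable

theorem abs_tailMixture_le (θ : Q.H) (x : 𝒳) (a : 𝒜) (t : ℝ) :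
    |Q.tailMixture θ x a t| ≤ ∫ s, |Q.mixture θ x a s| ∂Q.mS := by
  rw [← Real.norm_eq_abs, tailMixture]
  refine norm_integral_le_of_norm_le (Q.integrable_mixture θ x a).norm (ae_of_all _ fun s => ?_)
  by_cases h : s ∈ Set.Ici t <;> simp [h]

theorem sq_integral_abs_mixture_le (θ : Q.H) (x : 𝒳) (a : 𝒜) :
    (∫ s, |Q.mixture θ x a s| ∂Q.mS) ^ 2 ≤ ∫ s, Q.mixture θ x a s * Q.mixture θ x a s ∂Q.mS := by
  have := variance_nonneg |Q.mixture θ x a| Q.mS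
  rw [variance_eq_sub (Q.memLp_mixture θ x a 2).abs] at this
  simpa [sq] using this

theorem integral_tailMixture {Γ : Type*} [MeasurableSpace Γ] {μ : Measure Γ}
    [IsProbabilityMeasure μ] (θ η : Q.H) (x : 𝒳) (a : 𝒜) {Y : Γ → ℝ} (hY : Measurable Y)
    (hcdf : ∀ s ∈ Q.S, μ.real {ω | Y ω ≤ s} = Q.mixture η x a s) :
    ∫ ω, Q.tailMixture θ x a (Y ω) ∂μ = ∫ s, Q.mixture η x a s * Q.mixture θ x a s ∂Q.mS := by
  have hind : Measurable fun p : Γ × ℝ => (Set.Ici (Y p.1)).indicator (fun _ => (1 : ℝ)) p.2 :=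
    measurable_indicator_Ici_uncurry.comp ((hY.comp measurable_fst).prodMk measurable_snd)
  have hint : Integrable (Function.uncurry fun ω s =>
      (Set.Ici (Y ω)).indicator (fun _ => (1 : ℝ)) s * Q.mixture θ x a s) (μ.prod Q.mS) := by
    refine ((Q.integrable_mixture θ x a).comp_snd μ).bdd_mul (c := 1)
      hind.aestronglyMeasurable (ae_of_all _ fun p => ?_)
    by_cases h : p.2 ∈ Set.Ici (Y p.1) <;> simp [Set.indicator, h]
  simp only [tailMixture]
  rw [integral_integral_swap hint]
  refine integral_congr_ae ?_
  filter_upwards [ae_restrict_mem Q.measurableSet_S] with s hs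
  rw [integral_mul_const, ← hcdf s hs]
  congr 1
  have : (fun ω => (Set.Ici (Y ω)).indicator (fun _ => (1 : ℝ)) s) =
      {ω | Y ω ≤ s}.indicator 1 := by
    ext ω; simp [Set.indicator]
  rw [this, integral_indicator_one (measurableSet_le hY measurable_const)]

theorem IsSample.hasSubgaussianMGF {Γ : Type*} [MeasurableSpace Γ] {μ : Measure Γ}
    [IsProbabilityMeasure μ] {Q : Model 𝒳 𝒜 d} {η : Q.H} {n : ℕ} {x : Fin n → 𝒳} {a : Fin n → 𝒜}
    {y : Fin n → Γ → ℝ} (hy : Q.IsSample μ η x a y) (θ : Q.H) :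
    HasSubgaussianMGF
      (fun ω => ⟪θ, Q.response x a (fun j => y j ω) - Q.designOp x a η⟫_ℝ)
      (∑ j, (∫ s, Q.mixture θ (x j) (a j) s * Q.mixture θ (x j) (a j) s ∂Q.mS).toNNReal) μ := by
  have hterm : ∀ j ∈ Finset.univ, HasSubgaussianMGF (fun ω => Q.tailMixture θ (x j) (a j) (y j ω) -
      ∫ s, Q.mixture η (x j) (a j) s * Q.mixture θ (x j) (a j) s ∂Q.mS)
      (∫ s, Q.mixture θ (x j) (a j) s * Q.mixture θ (x j) (a j) s ∂Q.mS).toNNReal μ := by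
    intro j _
    -- values in `[-B, B]` give the proxy `B ^ 2`, at most `∫ F_θ²` as `m S = 1`
    set B := ∫ s, |Q.mixture θ (x j) (a j) s| ∂Q.mS
    have hB : 0 ≤ B := integral_nonneg fun s => abs_nonneg _
    have h := hasSubgaussianMGF_of_mem_Icc (μ := μ) (a := -B) (b := B)
      ((Q.measurable_tailMixture θ (x j) (a j)).comp (hy.measurable j)).aemeasurable
      (ae_of_all _ fun ω => abs_le.1 (Q.abs_tailMixture_le θ (x j) (a j) (y j ω)))
    simp only [Function.comp_apply] at h
    rw [Q.integral_tailMixture θ η _ _ (hy.measurable j) (hy.cdf_eq j)] at h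
    refine ⟨h.integrable_exp_mul, fun t => (h.mgf_le t).trans ?_⟩
    have hsq := Q.sq_integral_abs_mixture_le θ (x j) (a j)
    have hc : (((‖B - -B‖₊ / 2) ^ 2 : NNReal) : ℝ) = B ^ 2 := by
      push_cast
      rw [Real.norm_of_nonneg (by linarith)]; ring
    rw [hc, Real.coe_toNNReal _ ((sq_nonneg _).trans hsq)]
    gcongr
  have hindep : iIndepFun (fun j ω => Q.tailMixture θ (x j) (a j) (y j ω) -
      ∫ s, Q.mixture η (x j) (a j) s * Q.mixture θ (x j) (a j) s ∂Q.mS) μ :=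
    hy.indep.comp (fun j t => Q.tailMixture θ (x j) (a j) t -
      ∫ s, Q.mixture η (x j) (a j) s * Q.mixture θ (x j) (a j) s ∂Q.mS)
      fun j => (Q.measurable_tailMixture θ (x j) (a j)).sub_const _
  refine (HasSubgaussianMGF.sum_of_iIndepFun hindep hterm).congr (ae_of_all _ fun ω => ?_)
  simp only [Finset.sum_sub_distrib, inner_sub_right, inner_response,
    inner_designOp, tailMixture]

/-- The noise `response - U_D θ*` is sub-Gaussian with variance proxy `⟨θ, U_D θ⟩` in the
direction `θ`. -/
theorem IsSample.lintegral_exp_inner_le {Γ : Type*} [MeasurableSpace Γ] {μ : Measure Γ}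
    [IsProbabilityMeasure μ] {Q : Model 𝒳 𝒜 d} {η : Q.H} {n : ℕ} {x : Fin n → 𝒳} {a : Fin n → 𝒜}
    {y : Fin n → Γ → ℝ} (hy : Q.IsSample μ η x a y) (θ : Q.H) :
    ∫⁻ ω, ENNReal.ofReal
        (Real.exp ⟪θ, Q.response x a (fun j => y j ω) - Q.designOp x a η⟫_ℝ) ∂μ ≤
      ENNReal.ofReal (Real.exp (⟪θ, Q.designOp x a θ⟫_ℝ / 2)) := by
  have h := hy.hasSubgaussianMGF θ
  have hint := h.integrable_exp_mul 1
  have hle := h.mgf_le 1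
  simp only [one_mul, mgf] at hint hle
  rw [← ofReal_integral_eq_lintegral_ofReal hint (ae_of_all _ fun ω => (Real.exp_pos _).le)]
  refine ENNReal.ofReal_le_ofReal (hle.trans (le_of_eq ?_))
  rw [inner_designOp, NNReal.coe_sum, one_pow, mul_one]
  congr 2
  exact Finset.sum_congr rfl fun j _ => Real.coe_toNNReal _ (integral_nonneg fun s =>
    mul_self_nonneg _)

theorem IsSample.measurable_inner_response {Γ : Type*} [MeasurableSpace Γ] {μ : Measure Γ}
    {Q : Model 𝒳 𝒜 d} {η : Q.H} {n : ℕ} {x : Fin n → 𝒳} {a : Fin n → 𝒜}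
    {y : Fin n → Γ → ℝ} (hy : Q.IsSample μ η x a y) (θ : Q.H) :
    Measurable fun ω => ⟪θ, Q.response x a (fun j => y j ω)⟫_ℝ := by
  simp only [inner_response]
  exact Finset.measurable_sum _ fun j _ =>
    (Q.measurable_tailMixture θ (x j) (a j)).comp (hy.measurable j)

end Model

end FunctionalRegression

namespace FunctionalRegression

/-! ### The oracle bound -/

theorem mul_epsStar {γ : ℝ} (hγ : 0 < γ) {n : ℕ} (hn : 0 < n) :
    n * epsStar γ n = (n : ℝ) ^ (γ / (γ + 2)) := by
  have hn' : (0 : ℝ) < n := Nat.cast_pos.2 hn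
  rw [epsStar, ← Real.rpow_one_add' hn'.le]
  · congr 1
    field_simp
    ring
  · have : 1 + -2 / (γ + 2) = γ / (γ + 2) := by field_simp; ring
    rw [this]; positivity

theorem one_le_mul_epsStar {γ : ℝ} (hγ : 0 < γ) {n : ℕ} (hn : 0 < n) :
    1 ≤ n * epsStar γ n := by
  rw [mul_epsStar hγ hn]
  exact Real.one_le_rpow (Nat.one_le_cast.2 hn) (by positivity)

namespace Model

variable {𝒳 𝒜 : Type*} {d : ℕ} {Q : Model 𝒳 𝒜 d}

/-- On the event where the self-normalized noise is at most `B`, the oracle error is controlled. The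
retained eigenvalues are at least one, so that `1 / lam i ≤ 2 / (1 + lam i)`. -/
theorem IsOracleOutput.opNorm_sub_le {γ : ℝ} (hγ : 0 < γ) {M : ℝ} {θstar : Q.H}
    (hθ : θstar ∈ Q.coeffSet M) {n : ℕ} (hn : 0 < n) {x : Fin n → 𝒳} {a : Fin n → 𝒜}
    {lam : ℕ → ℝ} {e : ℕ → Q.H} (hU : IsSpectralDecomposition (Q.designOp x a) lam e)
    {y : Fin n → ℝ} {θhat : Q.H} (hθhat : Q.IsOracleOutput γ M x a lam e y θhat) {B : ℝ}
    (hB : ∑ i ∈ Finset.range (numRetained γ n lam),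
      ⟪Q.response x a y - Q.designOp x a θstar, e i⟫_ℝ ^ 2 / (1 + lam i) ≤ B) :
    opNorm (Q.designOp x a) (θhat - θstar) ≤
      Real.sqrt (2 * B) + (n : ℝ) ^ (γ / (γ + 2)) * M := by
  have hc := one_le_mul_epsStar hγ hn
  have hc0 : 0 < n * epsStar γ n := one_pos.trans_le hc
  have hM : 0 ≤ M := (norm_nonneg _).trans hθ.2.2
  refine (hU.opNorm_projection_sub_le (Q.convex_coeffSet M) hθhat hθ).trans ?_
  have hvar : ∑ i ∈ Finset.range (numRetained γ n lam),
      ⟪Q.response x a y - Q.designOp x a θstar, e i⟫_ℝ ^ 2 / lam i ≤ 2 * B := by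
    refine le_trans ?_ (mul_le_mul_of_nonneg_left hB zero_le_two)
    rw [Finset.mul_sum]
    refine Finset.sum_le_sum fun i hi => ?_
    have hl : 1 ≤ lam i :=
      hc.trans (hU.le_eigenvalue_of_lt_truncIndex (Finset.mem_range.1 hi))
    rw [← mul_div_assoc, div_le_div_iff₀ (by linarith) (by linarith)]
    nlinarith [mul_nonneg (sq_nonneg
      ⟪Q.response x a y - Q.designOp x a θstar, e i⟫_ℝ) (sub_nonneg.2 hl)]
  have hbias : n * epsStar γ n * ‖θstar‖ ^ 2 ≤ (n * epsStar γ n * M) ^ 2 := by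
    have h1 : ‖θstar‖ ^ 2 ≤ M ^ 2 := pow_le_pow_left₀ (norm_nonneg _) hθ.2.2 2
    calc n * epsStar γ n * ‖θstar‖ ^ 2
        ≤ (n * epsStar γ n) ^ 2 * M ^ 2 :=
          mul_le_mul (le_self_pow₀ hc two_ne_zero) h1 (sq_nonneg _) (sq_nonneg _)
      _ = _ := by ring
  have h2B : 0 ≤ 2 * B := hvar.trans' (Finset.sum_nonneg fun i _ =>
    div_nonneg (sq_nonneg _) (hU.eigenvalue_nonneg i))
  rw [← mul_epsStar hγ hn]
  calc opNorm (Q.designOp x a)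
        (truncPinv lam e (numRetained γ n lam) (Q.response x a y) - θstar)
      ≤ Real.sqrt (2 * B + (n * epsStar γ n * M) ^ 2) :=
        Real.sqrt_le_sqrt ((hU.inner_truncPinv_sub_le hc0 _ _).trans (add_le_add hvar hbias))
    _ ≤ Real.sqrt (2 * B) + n * epsStar γ n * M := by
        have hb : 0 ≤ n * epsStar γ n * M := by positivity
        refine Real.sqrt_le_iff.2 ⟨by positivity, ?_⟩
        nlinarith [Real.sq_sqrt h2B, mul_nonneg (Real.sqrt_nonneg (2 * B)) hb]

/-- Self-normalized deviation inequality for the coordinates of the noise along eigenvectors. -/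
theorem IsSample.measureReal_sum_inner_sq_le {Γ : Type*} [MeasurableSpace Γ] {μ : Measure Γ}
    [IsProbabilityMeasure μ] {η : Q.H} {n : ℕ} {x : Fin n → 𝒳} {a : Fin n → 𝒜}
    {y : Fin n → Γ → ℝ} (hy : Q.IsSample μ η x a y) {lam : ℕ → ℝ} {e : ℕ → Q.H}
    (hU : IsSpectralDecomposition (Q.designOp x a) lam e) {N : ℕ} (hN : ∀ i < N, lam i ≠ 0)
    {δ : ℝ} (hδ : 0 < δ) :
    1 - δ ≤ μ.real {ω | ∑ i ∈ Finset.range N,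
      ⟪Q.response x a (fun j => y j ω) - Q.designOp x a η, e i⟫_ℝ ^ 2 / (1 + lam i) ≤
        2 * Real.log (1 / δ) + ∑ i ∈ Finset.range N, Real.log (1 + lam i)} := by
  have h := measureReal_sum_sq_le μ (ι := Fin N) (lam := fun i => lam i)
    (ξ := fun i ω => ⟪Q.response x a (fun j => y j ω) - Q.designOp x a η, e i⟫_ℝ)
    (fun i => ?_) (fun i => hU.eigenvalue_nonneg i) (fun t => ?_) hδ
  · simpa only [Finset.sum_range] using h
  · simp only [real_inner_comm (e i), inner_sub_right]
    exact (hy.measurable_inner_response (e i)).sub_const _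
  · have := hy.lintegral_exp_inner_le (∑ i : Fin N, t i • e i)
    rw [hU.inner_apply_sum_self (fun i => hN i i.2), Finset.sum_div] at this
    simpa only [sum_inner, real_inner_smul_left, real_inner_comm (e _)] using this

end Model

end FunctionalRegression

theorem mainTheorem3 {𝒳 𝒜 : Type*} {d : ℕ} (Q : FunctionalRegression.Model 𝒳 𝒜 d)
    (γ : ℝ) (hγ0 : 0 < γ) (hγ1 : γ ≤ 1) (M : ℝ)
    (θstar : Q.H) (hθ : θstar ∈ Q.coeffSet M)
    {n : ℕ} (hn : 0 < n) (x : Fin n → 𝒳) (a : Fin n → 𝒜)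
    (lam : ℕ → ℝ) (e : ℕ → Q.H)
    (hU : FunctionalRegression.IsSpectralDecomposition (Q.designOp x a) lam e)
    {Γ : Type*} [MeasurableSpace Γ] (μ : MeasureTheory.Measure Γ)
    [MeasureTheory.IsProbabilityMeasure μ]
    (y : Fin n → Γ → ℝ) (hy : Q.IsSample μ θstar x a y)
    (θhat : Γ → Q.H)
    (hθhat : ∀ ω, Q.IsOracleOutput γ M x a lam e (fun j => y j ω) (θhat ω))
    (δ : ℝ) (hδ0 : 0 < δ) (hδ1 : δ < 1) :
    1 - δ ≤ μ.real {ω | FunctionalRegression.opNorm (Q.designOp x a) (θhat ω - θstar) ≤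
      Real.sqrt (2 * (2 * Real.log (1 / δ) +
        ∑ i ∈ Finset.range (FunctionalRegression.numRetained γ n lam), Real.log (1 + lam i))) +
      (n : ℝ) ^ (γ / (γ + 2)) * M} := by
  have hN : ∀ i < FunctionalRegression.numRetained γ n lam, lam i ≠ 0 := fun i hi =>
    (one_pos.trans_le ((FunctionalRegression.one_le_mul_epsStar hγ0 hn).trans
      (hU.le_eigenvalue_of_lt_truncIndex hi))).ne'
  refine (hy.measureReal_sum_inner_sq_le hU hN hδ0).trans (MeasureTheory.measureReal_mono ?_)
  exact fun ω hω => (hθhat ω).opNorm_sub_le hγ0 hθ hn hU hω
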